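/- Let $G$ be a finite simple graph with $n$ vertices and exactly $2n-2$ edges. Suppose that no subgraph $H\neq G$ of $G$ (induced or not) has minimum degree $3$. Then $G$ is pancyclic, that is, $G$ contains a cycle of length $i$ for every integer $i$ with $3\le i\le n$. -/

import Mathlib

open Classical in
/-- The subgraph `H`, regarded as a graph on its own vertex set, has minimum degree `d`.
(For `d ≠ 0` this excludes the subgraph without vertices, whose `minDegree` is `0`.) -/
def SubgraphHasMinDegree {V : Type*} [Fintype V] {G : SimpleGraph V}
    (H : G.Subgraph) (d : ℕ) : Prop :=
  H.coe.minDegree = d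

/-- A finite graph is pancyclic if it contains a cycle of every length from `3` up to its number
of vertices. -/
def IsPancyclic {V : Type*} [Fintype V] (G : SimpleGraph V) : Prop :=
  ∀ i : ℕ, 3 ≤ i → i ≤ Fintype.card V →
    ∃ (u : V) (p : G.Walk u u), p.IsCycle ∧ p.length = i

set_option linter.unusedSectionVars false

/-! ### Subgraphs of minimum degree three -/

namespace SimpleGraph

variable {V : Type*} [Fintype V] {G : SimpleGraph V}

/-! Peeling off vertices of degree at most two shows that a proper set `S` of at least two vertices
spans at most `2|S| - 3` edges; the whole graph has one edge more than this bound. (`adjCount S S`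
counts ordered pairs, hence every edge twice.) So all degrees are at least three, and the noncubic
vertices are independent, since an edge between two of them could be deleted.

A component `C` of the cubic vertices must then induce a tree, and its complement attains the bound,
so some noncubic vertex has just two neighbours outside `C`. If there are `k ≥ 2` noncubic vertices,
there are `2k - 2` components. For `k ≥ 3` two components share such a vertex, and removing both
together with it leaves too many edges; hence `k ≤ 2` (`card_degree_ne_three_le_two`).

For `k ≤ 1` the graph is a wheel. For `k = 2` there are two cubic paths, each completely joined to
one noncubic vertex and with an end joined to the other (`exists_fan`). Truncating the paths gives
cycles of all lengths. -/

lemma subgraphHasMinDegree_iff (H : G.Subgraph) (hne : H.verts.Nonempty) (d : ℕ)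
    (hge : ∀ v ∈ H.verts, d ≤ (H.neighborSet v).ncard)
    (hle : ∃ v ∈ H.verts, (H.neighborSet v).ncard ≤ d) : SubgraphHasMinDegree H d := by
  classical
  unfold SubgraphHasMinDegree
  have key : ∀ (v : H.verts) [Fintype (H.coe.neighborSet v)], H.coe.degree v = (H.neighborSet v).ncard := by
    intro v _
    rw [← Nat.card_coe_set_eq, ← Nat.card_congr (H.coeNeighborSetEquiv v), ← card_neighborSet_eq_degree,
      Nat.card_eq_fintype_card]
  have : Nonempty H.verts := hne.to_subtype
  apply le_antisymm
  · obtain ⟨v, hv, h⟩ := hle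
    have := H.coe.minDegree_le_degree ⟨v, hv⟩
    rw [key] at this
    convert this.trans h
  · have := H.coe.le_minDegree_of_forall_le_degree d (fun v => by rw [key]; exact hge v v.2)
    convert this

lemma Subgraph.ncard_neighborSet_le_deleteEdges (H : G.Subgraph) (u v a : V) :
    (H.neighborSet a).ncard ≤ ((H.deleteEdges {s(u, v)}).neighborSet a).ncard + 1 := by
  classical
  have : H.neighborSet a \ {if a = u then v else u} ⊆
      (H.deleteEdges {s(u, v)}).neighborSet a := by
    rintro b ⟨hb, hb'⟩
    simp only [Subgraph.mem_neighborSet, Subgraph.deleteEdges_adj, Set.mem_singleton_iff] at *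
    refine ⟨hb, fun h => hb' ?_⟩
    rcases Sym2.eq_iff.1 h with ⟨rfl, rfl⟩ | ⟨rfl, rfl⟩
    · simp
    · split_ifs with h1 <;> simp_all
  have h1 := Set.ncard_le_ncard this (Set.toFinite _)
  have h2 := Set.ncard_le_ncard_sdiff_add_ncard (H.neighborSet a)
    {if a = u then v else u} (Set.toFinite _)
  rw [Set.ncard_singleton] at h2
  omega

/-- A proper subgraph of minimum degree at least `3` yields one of minimum degree exactly `3`. -/
lemma false_of_three_le_ncard_neighborSet
    (hG : ∀ H : G.Subgraph, H ≠ ⊤ → ¬ SubgraphHasMinDegree H 3)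
    (H : G.Subgraph) (hH : H ≠ ⊤) (hne : H.verts.Nonempty)
    (hdeg : ∀ v ∈ H.verts, 3 ≤ (H.neighborSet v).ncard) : False := by
  classical
  -- While all degrees exceed three, deleting an edge keeps them at least three; finiteness forces
  -- some degree to reach three.
  induction H using WellFoundedLT.induction with
  | ind H ih =>
    by_cases hle : ∃ v ∈ H.verts, (H.neighborSet v).ncard ≤ 3
    · exact hG H hH (subgraphHasMinDegree_iff H hne 3 hdeg hle)
    · push Not at hle
      obtain ⟨v, hv⟩ := hne
      have hpos : 0 < (H.neighborSet v).ncard := by have := hle v hv; omega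
      obtain ⟨u, hu⟩ := (Set.ncard_pos (Set.toFinite _)).1 hpos
      have hlt : H.deleteEdges {s(v, u)} < H := by
        refine lt_of_le_of_ne (Subgraph.deleteEdges_le _) fun h => ?_
        have h2 : (H.deleteEdges {s(v, u)}).Adj v u := by rw [h]; exact hu
        simp at h2
      refine ih _ hlt (fun h => ?_) ⟨v, hv⟩ fun a ha => ?_
      · rw [h] at hlt
        exact not_top_lt hlt
      · have := H.ncard_neighborSet_le_deleteEdges v u a
        have := hle a ha
        omega

/-! ### Double counting of edges -/

section Count

variable [DecidableEq V] (G) [DecidableRel G.Adj]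

/-- The number of neighbours of `v` in `S`. -/
def degIn (S : Finset V) (v : V) : ℕ := (S.filter (G.Adj v)).card

/-- The number of pairs `(x, y)` with `x ∈ A` adjacent to `y ∈ B`. -/
def adjCount (A B : Finset V) : ℕ := ∑ v ∈ A, G.degIn B v

lemma degIn_union {A B : Finset V} (h : Disjoint A B) (v : V) :
    G.degIn (A ∪ B) v = G.degIn A v + G.degIn B v := by
  unfold degIn
  rw [Finset.filter_union, Finset.card_union_of_disjoint (Finset.disjoint_filter_filter h)]

lemma degIn_mono {A B : Finset V} (h : A ⊆ B) (v : V) : G.degIn A v ≤ G.degIn B v :=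
  Finset.card_le_card (Finset.filter_subset_filter _ h)

lemma degIn_univ (v : V) : G.degIn Finset.univ v = G.degree v := by
  rw [degIn, ← card_neighborFinset_eq_degree, neighborFinset_eq_filter]

lemma degIn_singleton (v w : V) : G.degIn {w} v = if G.Adj v w then 1 else 0 := by
  unfold degIn
  rw [Finset.filter_singleton]
  split_ifs <;> simp

lemma degIn_eq_zero {S : Finset V} {v : V} : G.degIn S v = 0 ↔ ∀ x ∈ S, ¬ G.Adj v x := by
  rw [degIn, Finset.card_eq_zero, Finset.filter_eq_empty_iff]

lemma degIn_compl (A : Finset V) (v : V) : G.degIn A v + G.degIn Aᶜ v = G.degree v := by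
  rw [← degIn_union _ disjoint_compl_right, Finset.union_compl, degIn_univ]

lemma adjCount_comm (A B : Finset V) : G.adjCount A B = G.adjCount B A := by
  unfold adjCount degIn
  have := Finset.sum_card_bipartiteAbove_eq_sum_card_bipartiteBelow (s := A) (t := B) G.Adj
  unfold Finset.bipartiteAbove Finset.bipartiteBelow at this
  rw [this]
  simp_rw [G.adj_comm]

lemma adjCount_union_right {A B : Finset V} (h : Disjoint A B) (C : Finset V) :
    G.adjCount C (A ∪ B) = G.adjCount C A + G.adjCount C B := by
  unfold adjCount
  rw [← Finset.sum_add_distrib]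
  exact Finset.sum_congr rfl fun v _ => G.degIn_union h v

lemma adjCount_union_left {A B : Finset V} (h : Disjoint A B) (C : Finset V) :
    G.adjCount (A ∪ B) C = G.adjCount A C + G.adjCount B C :=
  Finset.sum_union h

lemma adjCount_union_self {A B : Finset V} (h : Disjoint A B) :
    G.adjCount (A ∪ B) (A ∪ B) = G.adjCount A A + 2 * G.adjCount A B + G.adjCount B B := by
  rw [adjCount_union_left _ h, adjCount_union_right _ h, adjCount_union_right _ h,
    G.adjCount_comm B A]
  ring

lemma adjCount_singleton_left (v : V) (B : Finset V) : G.adjCount {v} B = G.degIn B v :=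
  Finset.sum_singleton _ _

lemma adjCount_singleton_right (v : V) (B : Finset V) : G.adjCount B {v} = G.degIn B v := by
  rw [adjCount_comm, adjCount_singleton_left]

lemma adjCount_singleton_self (v : V) : G.adjCount {v} {v} = 0 := by
  rw [adjCount_singleton_left, degIn_singleton, if_neg (G.irrefl)]

lemma adjCount_erase {S : Finset V} {v : V} (hv : v ∈ S) :
    G.adjCount S S = G.adjCount (S.erase v) (S.erase v) + 2 * G.degIn S v := by
  have hd : Disjoint ({v} : Finset V) (S.erase v) := by simp
  have hS : S = {v} ∪ S.erase v := by
    rw [← Finset.insert_eq, Finset.insert_erase hv]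
  have h1 := G.adjCount_union_self hd
  have h2 := G.degIn_union hd v
  rw [← hS] at h1 h2
  rw [adjCount_singleton_self, adjCount_singleton_left] at h1
  rw [degIn_singleton, if_neg (G.irrefl)] at h2
  omega

/-- Edges inside `C` are counted twice among those meeting `C`; the correction stands on the left to
avoid subtraction. -/
lemma adjCount_sdiff {S C : Finset V} (h : C ⊆ S) :
    G.adjCount S S + G.adjCount C C = 2 * G.adjCount C S + G.adjCount (S \ C) (S \ C) := by
  have hd : Disjoint C (S \ C) := Finset.disjoint_sdiff
  have h1 := G.adjCount_union_self hd
  have h2 := G.adjCount_union_right hd C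
  rw [Finset.union_sdiff_of_subset h] at h1 h2
  omega

lemma adjCount_eq_zero {A B : Finset V} (h : ∀ a ∈ A, ∀ b ∈ B, ¬ G.Adj a b) :
    G.adjCount A B = 0 :=
  Finset.sum_eq_zero fun a ha => G.degIn_eq_zero.2 (h a ha)

lemma adjCount_univ_right (A : Finset V) : G.adjCount A Finset.univ = ∑ v ∈ A, G.degree v :=
  Finset.sum_congr rfl fun v _ => G.degIn_univ v

lemma adjCount_univ_of_degree_eq {A : Finset V} {d : ℕ} (h : ∀ v ∈ A, G.degree v = d) :
    G.adjCount A Finset.univ = A.card * d := by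
  rw [adjCount_univ_right, Finset.sum_congr rfl h, Finset.sum_const, smul_eq_mul]

lemma adjCount_univ : G.adjCount Finset.univ Finset.univ = 2 * G.edgeFinset.card := by
  rw [adjCount_univ_right, sum_degrees_eq_twice_card_edges]

/-- Every bipartition of `S` into two nonempty parts is crossed by an edge. -/
def CutConnected (S : Finset V) : Prop :=
  ∀ X ⊆ S, X.Nonempty → X ≠ S → ∃ x ∈ X, ∃ y ∈ S \ X, G.Adj x y

variable {G}

/-- A connected set spans at least `|S| - 1` edges: grown from one vertex, it gains an edge with
each new vertex. -/
lemma CutConnected.two_mul_card_le {S : Finset V} (hS : G.CutConnected S) :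
    2 * S.card ≤ G.adjCount S S + 2 := by
  rcases S.eq_empty_or_nonempty with rfl | ⟨a, ha⟩
  · simp
  have key : ∀ j, j + 1 ≤ S.card → ∃ X ⊆ S, X.card = j + 1 ∧ 2 * j ≤ G.adjCount X X := by
    intro j
    induction j with
    | zero => exact fun _ => ⟨{a}, by simpa using ha, by simp, by simp⟩
    | succ j ih =>
      intro hj
      obtain ⟨X, hXS, hX, hc⟩ := ih (by omega)
      obtain ⟨x, hx, y, hy, hxy⟩ := hS X hXS (Finset.card_pos.1 (by omega))
        (fun h => by subst h; omega)
      rw [Finset.mem_sdiff] at hy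
      refine ⟨insert y X, Finset.insert_subset hy.1 hXS, by
        rw [Finset.card_insert_of_notMem hy.2, hX], ?_⟩
      have h1 := G.adjCount_erase (Finset.mem_insert_self y X)
      rw [Finset.erase_insert hy.2] at h1
      have h2 : 0 < G.degIn (insert y X) y :=
        Finset.card_pos.2 ⟨x, by simp [hx, hxy.symm]⟩
      omega
  obtain ⟨X, hXS, hX, hc⟩ := key (S.card - 1) (by have := Finset.card_pos.2 ⟨a, ha⟩; omega)
  have : 0 < S.card := Finset.card_pos.2 ⟨a, ha⟩
  rw [Finset.eq_of_subset_of_card_le hXS (by omega)] at hc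
  omega

end Count

end SimpleGraph

/-! ### Paths as lists and Hamiltonian paths -/

namespace SimpleGraph

variable {V : Type*} {G : SimpleGraph V}

/-- A vertex adjacent to both ends of a path closes it to a cycle. -/
lemma exists_isCycle_of_isChain {x : V} {l : List V} (hc : l.IsChain G.Adj) (hn : l.Nodup)
    (hx : x ∉ l) (hl : 2 ≤ l.length) (hhead : ∀ a ∈ l.head?, G.Adj x a)
    (hlast : ∀ a ∈ l.getLast?, G.Adj x a) :
    ∃ (u : V) (p : G.Walk u u), p.IsCycle ∧ p.length = l.length + 1 := by
  have hne : l ≠ [] := by rintro rfl; simp at hl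
  have h1 := hhead _ (List.head_mem_head? hne)
  have h2 := hlast _ (List.getLast_mem_getLast? hne)
  set p := Walk.ofSupport l hne hc with hp
  have hps : p.support = l := Walk.support_ofSupport ..
  have hpath : p.IsPath := by rw [Walk.isPath_def, hps]; exact hn
  have hab : l.head hne ≠ l.getLast hne := by
    obtain ⟨a, b, l, rfl⟩ : ∃ a b l', l = a :: b :: l' := by
      match l, hl with
      | a :: b :: l, _ => exact ⟨a, b, l, rfl⟩
    intro h
    simp only [List.head_cons, List.getLast_cons_cons] at h
    rw [List.nodup_cons] at hn
    exact hn.1 (h ▸ List.getLast_mem _)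
  have hxp : x ∉ p.support := by rw [hps]; exact hx
  refine ⟨x, .cons h1 (p.concat h2.symm), ?_, ?_⟩
  · rw [Walk.cons_isCycle_iff]
    refine ⟨hpath.concat hxp h2.symm, ?_⟩
    rw [Walk.edges_concat, List.concat_eq_append, List.mem_append, List.mem_singleton]
    rintro (h | h)
    · exact hxp (p.fst_mem_support_of_mem_edges h)
    · rcases Sym2.eq_iff.1 h with ⟨h, -⟩ | ⟨-, h⟩
      · exact h2.ne h
      · exact hab h
  · have := p.length_support
    rw [hps] at this
    simp [this]

variable [DecidableEq V] [DecidableRel G.Adj]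

lemma card_le_degIn {S A : Finset V} {v : V} (hA : A ⊆ S) (h : ∀ a ∈ A, G.Adj v a) :
    A.card ≤ G.degIn S v :=
  Finset.card_le_card fun a ha => Finset.mem_filter.2 ⟨hA ha, h a ha⟩

/-- In a set inducing maximum degree at most two, the neighbours of the inner vertices of a path
lie on the path. -/
lemma eq_cons_or_eq_concat_of_adj {R : Finset V} (hdeg : ∀ v ∈ R, G.degIn R v ≤ 2) {l : List V}
    (hc : l.IsChain G.Adj) (hn : l.Nodup) (hlR : ∀ v ∈ l, v ∈ R) {v x : V} (hv : v ∈ l)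
    (hxR : x ∈ R) (hxl : x ∉ l) (hvx : G.Adj v x) :
    (∃ b, l = v :: b) ∨ ∃ a, l = a ++ [v] := by
  obtain ⟨a, b, rfl⟩ := List.append_of_mem hv
  rcases a.eq_nil_or_concat with rfl | ⟨a, u, rfl⟩
  · exact .inl ⟨b, rfl⟩
  cases b with
  | nil => exact .inr ⟨_, rfl⟩
  | cons w b =>
    exfalso
    have h3 : ({u, w, x} : Finset V).card = 3 := by
      rw [Finset.card_eq_three]
      refine ⟨u, w, x, ?_, ?_, ?_, rfl⟩ <;> rintro rfl <;> simp_all [List.nodup_append]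
    have huv : G.Adj u v ∧ G.Adj v w := by
      simp_all [List.isChain_append]
    have := card_le_degIn (G := G) (S := R) (A := {u, w, x}) (v := v)
      (by intro z hz; simp only [Finset.mem_insert, Finset.mem_singleton] at hz
          rcases hz with rfl | rfl | rfl
          · exact hlR _ (by simp)
          · exact hlR _ (by simp)
          · exact hxR)
      (by intro z hz; simp only [Finset.mem_insert, Finset.mem_singleton] at hz
          rcases hz with rfl | rfl | rfl
          · exact huv.1.symm
          · exact huv.2
          · exact hvx)
    have := hdeg v (hlR v hv)
    omega

/-- A longest path with a given property. -/
lemma exists_longest_path {R : Finset V} (P : List V → Prop) {l₀ : List V}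
    (h₀ : l₀.IsChain G.Adj ∧ l₀.Nodup ∧ (∀ v ∈ l₀, v ∈ R) ∧ P l₀) :
    ∃ l : List V, (l.IsChain G.Adj ∧ l.Nodup ∧ (∀ v ∈ l, v ∈ R) ∧ P l) ∧
      ∀ l' : List V, (l'.IsChain G.Adj ∧ l'.Nodup ∧ (∀ v ∈ l', v ∈ R) ∧ P l') →
        l'.length ≤ l.length := by
  classical
  let Q : ℕ → Prop := fun k => ∃ l : List V,
    (l.IsChain G.Adj ∧ l.Nodup ∧ (∀ v ∈ l, v ∈ R) ∧ P l) ∧ l.length = k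
  have hb : ∀ k, Q k → k ≤ R.card := by
    rintro k ⟨l, ⟨-, hn, hR, -⟩, rfl⟩
    rw [← List.toFinset_card_of_nodup hn]
    exact Finset.card_le_card fun v hv => hR v (List.mem_toFinset.1 hv)
  obtain ⟨l, hl, hlen⟩ := Nat.findGreatest_spec (P := Q) (hb _ ⟨l₀, h₀, rfl⟩) ⟨l₀, h₀, rfl⟩
  exact ⟨l, hl, fun l' hl' => hlen ▸ Nat.le_findGreatest (hb _ ⟨l', hl', rfl⟩) ⟨l', hl', rfl⟩⟩

lemma CutConnected.exists_adj_of_list {R : Finset V} (hR : G.CutConnected R) {l : List V}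
    (hlR : ∀ v ∈ l, v ∈ R) (hne : l ≠ []) (h : ¬ ∀ v ∈ R, v ∈ l) :
    ∃ v ∈ l, ∃ x ∈ R, x ∉ l ∧ G.Adj v x := by
  obtain ⟨v, hv, x, hx, hvx⟩ := hR l.toFinset (fun v hv => hlR v (List.mem_toFinset.1 hv))
    (by simpa [Finset.nonempty_iff_ne_empty] using hne)
    (fun h' => h fun v hv => List.mem_toFinset.1 (h' ▸ hv))
  simp only [List.mem_toFinset, Finset.mem_sdiff] at hv hx
  exact ⟨v, hv, x, hx.1, hx.2, hvx⟩

lemma length_eq_card_of_mem_iff {R : Finset V} {l : List V} (hn : l.Nodup)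
    (hlR : ∀ v ∈ l, v ∈ R) (h : ∀ v ∈ R, v ∈ l) : l.length = R.card := by
  rw [← List.toFinset_card_of_nodup hn]
  congr 1
  ext v
  rw [List.mem_toFinset]
  exact ⟨hlR v, h v⟩

lemma isChain_concat {l : List V} {v x : V} (hc : (l ++ [v]).IsChain G.Adj) (h : G.Adj v x) :
    (l ++ [v] ++ [x]).IsChain G.Adj := by
  rw [List.isChain_append]
  exact ⟨hc, by simp, by simpa using h⟩

/-- A connected set inducing maximum degree at most two has a Hamiltonian path. -/
lemma CutConnected.exists_hamiltonian_path {R : Finset V} (hR : G.CutConnected R)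
    (hne : R.Nonempty) (hdeg : ∀ v ∈ R, G.degIn R v ≤ 2) :
    ∃ l : List V, l.IsChain G.Adj ∧ l.Nodup ∧ (∀ v ∈ l, v ∈ R) ∧ l.length = R.card := by
  obtain ⟨q, hq⟩ := hne
  obtain ⟨l, ⟨hc, hn, hlR, hl⟩, hmax⟩ := exists_longest_path (G := G) (R := R) (· ≠ [])
    (l₀ := [q]) (by simpa using hq)
  refine ⟨l, hc, hn, hlR, length_eq_card_of_mem_iff hn hlR ?_⟩
  -- By connectivity a missed vertex is adjacent to the path, necessarily at an end, and extends it.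
  by_contra hcon
  obtain ⟨v, hv, x, hxR, hxl, hvx⟩ := hR.exists_adj_of_list hlR hl hcon
  rcases eq_cons_or_eq_concat_of_adj hdeg hc hn hlR hv hxR hxl hvx with ⟨b, rfl⟩ | ⟨a, rfl⟩
  · have := hmax (x :: v :: b) ⟨List.isChain_cons_cons.2 ⟨hvx.symm, hc⟩,
      List.nodup_cons.2 ⟨hxl, hn⟩, by
        intro z hz
        rcases List.mem_cons.1 hz with rfl | hz
        exacts [hxR, hlR z hz], by simp⟩
    simp at this
  · have := hmax (a ++ [v] ++ [x]) ⟨isChain_concat hc hvx,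
      List.nodup_append.2 ⟨hn, by simp, by
        rintro z hz y hy rfl
        exact hxl (List.mem_singleton.1 hy ▸ hz)⟩, by
        intro z hz
        rcases List.mem_append.1 hz with hz | hz
        exacts [hlR z hz, List.mem_singleton.1 hz ▸ hxR], by simp⟩
    simp at this

/-- A connected set inducing maximum degree at most two has a Hamiltonian path starting at any
vertex of degree at most one. -/
lemma CutConnected.exists_hamiltonian_path_from {R : Finset V} (hR : G.CutConnected R)
    (hdeg : ∀ v ∈ R, G.degIn R v ≤ 2) {q : V} (hq : q ∈ R) (hq1 : G.degIn R q ≤ 1) :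
    ∃ l : List V, (q :: l).IsChain G.Adj ∧ (q :: l).Nodup ∧ (∀ v ∈ q :: l, v ∈ R) ∧
      (q :: l).length = R.card := by
  obtain ⟨l, ⟨hc, hn, hlR, l, rfl⟩, hmax⟩ := exists_longest_path (G := G) (R := R)
    (fun l => ∃ l', l = q :: l') (l₀ := [q]) (by simpa using hq)
  refine ⟨l, hc, hn, hlR, length_eq_card_of_mem_iff hn hlR ?_⟩
  by_contra hcon
  obtain ⟨v, hv, x, hxR, hxl, hvx⟩ := hR.exists_adj_of_list hlR (by simp) hcon
  -- The path can only grow at its far end: at `q` the successor already uses up the one allowed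
  -- neighbour, unless `q` is itself the far end.
  have hend : ∃ a, q :: l = a ++ [v] := by
    rcases eq_cons_or_eq_concat_of_adj hdeg hc hn hlR hv hxR hxl hvx with ⟨b, hb⟩ | h
    · obtain ⟨rfl, rfl⟩ := List.cons.inj hb
      cases l with
      | nil => exact ⟨[], rfl⟩
      | cons w l =>
        exfalso
        have hwx : w ≠ x := by rintro rfl; simp at hxl
        have := card_le_degIn (G := G) (S := R) (A := {w, x}) (v := q)
          (by intro z hz; simp only [Finset.mem_insert, Finset.mem_singleton] at hz
              rcases hz with rfl | rfl
              · exact hlR _ (by simp)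
              · exact hxR)
          (by intro z hz; simp only [Finset.mem_insert, Finset.mem_singleton] at hz
              rcases hz with rfl | rfl
              · exact (List.isChain_cons_cons.1 hc).1
              · exact hvx)
        rw [Finset.card_pair hwx] at this
        omega
    · exact h
  obtain ⟨a, ha⟩ := hend
  have := hmax (q :: l ++ [x]) ⟨by rw [ha] at hc ⊢; exact isChain_concat hc hvx,
      List.nodup_append.2 ⟨hn, by simp, by
        rintro z hz y hy rfl
        exact hxl (List.mem_singleton.1 hy ▸ hz)⟩, by
        intro z hz
        rcases List.mem_append.1 hz with hz | hz
        exacts [hlR z hz, List.mem_singleton.1 hz ▸ hxR], ⟨l ++ [x], rfl⟩⟩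
  simp at this

end SimpleGraph

/-! ### Cycles through two hubs -/

namespace SimpleGraph

variable {V : Type*} {G : SimpleGraph V}

/-- Two disjoint paths `p` and `q`, with `q` running from a neighbour of `y` to a neighbour of `x`
and `p` starting at a neighbour of `y` and ending at a neighbour of `x`, form a cycle with `x`
and `y`. -/
lemma exists_isCycle_of_two_paths {x y : V} (hxy : x ≠ y) {p q : List V}
    (hp : p.IsChain G.Adj) (hpn : p.Nodup) (hq : q.IsChain G.Adj) (hqn : q.Nodup)
    (hpx : x ∉ p) (hpy : y ∉ p) (hqx : x ∉ q) (hqy : y ∉ q) (hpq : ∀ a ∈ p, a ∉ q)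
    (hp0 : p ≠ []) (hq0 : q ≠ [])
    (hph : ∀ a ∈ p.head?, G.Adj y a) (hpl : ∀ a ∈ p.getLast?, G.Adj x a)
    (hqh : ∀ a ∈ q.head?, G.Adj y a) (hql : ∀ a ∈ q.getLast?, G.Adj x a) :
    ∃ (u : V) (c : G.Walk u u), c.IsCycle ∧ c.length = p.length + q.length + 2 := by
  have hlen : (p.reverse ++ y :: q).length + 1 = p.length + q.length + 2 := by simp; omega
  rw [← hlen]
  have hp1 := List.length_pos_iff.2 hp0
  have hq1 := List.length_pos_iff.2 hq0
  refine exists_isCycle_of_isChain (x := x) ?_ ?_ ?_ ?_ ?_ ?_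
  · rw [List.isChain_append]
    refine ⟨?_, List.isChain_cons.2 ⟨hqh, hq⟩, ?_⟩
    · rw [List.isChain_reverse]
      exact hp.imp fun a b h => h.symm
    · intro a ha b hb
      rw [List.getLast?_reverse] at ha
      simp only [List.head?_cons, Option.mem_def, Option.some.injEq] at hb
      exact hb ▸ (hph a ha).symm
  · rw [List.nodup_append]
    refine ⟨List.nodup_reverse.2 hpn, List.nodup_cons.2 ⟨hqy, hqn⟩, ?_⟩
    rintro a ha b hb rfl
    rw [List.mem_reverse] at ha
    rcases List.mem_cons.1 hb with rfl | hb
    exacts [hpy ha, hpq a ha hb]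
  · simp [hpx, hqx, hxy]
  · simp; omega
  · intro a ha
    rw [List.head?_append_of_ne_nil _ (by simpa using hp0), List.head?_reverse] at ha
    exact hpl a ha
  · intro a ha
    obtain ⟨b, q, rfl⟩ := List.exists_cons_of_ne_nil hq0
    refine hql a ?_
    simpa using ha

/-- Initial segments of both paths close up through `x` and `y`, since every vertex of a path is
adjacent to its hub. The disjunction records whether the two paths have the same hub. -/
lemma exists_isCycle_of_two_fans {x y : V} (hxy : x ≠ y) {p q : List V}
    (hp : p.IsChain G.Adj) (hpn : p.Nodup) (hq : q.IsChain G.Adj) (hqn : q.Nodup)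
    (hpx : x ∉ p) (hpy : y ∉ p) (hqx : x ∉ q) (hqy : y ∉ q) (hpq : ∀ a ∈ p, a ∉ q)
    (hp2 : 2 ≤ p.length) (hq0 : q ≠ [])
    (hxp : ∀ a ∈ p, G.Adj x a) (hyp : ∀ a ∈ p.head?, G.Adj y a)
    (h : ((∀ a ∈ q, G.Adj x a) ∧ ∀ a ∈ q.head?, G.Adj y a) ∨
      ((∀ a ∈ q, G.Adj y a) ∧ ∀ a ∈ q.head?, G.Adj x a))
    {i : ℕ} (hi : 3 ≤ i) (hi' : i ≤ p.length + q.length + 2) :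
    ∃ (u : V) (c : G.Walk u u), c.IsCycle ∧ c.length = i := by
  have hq1 := List.length_pos_iff.2 hq0
  rcases hi.eq_or_lt with rfl | hi
  · have hlen : (p.take 2).length = 2 := by simp [hp2]
    have := exists_isCycle_of_isChain (G := G) (x := x) (l := p.take 2) (hp.take 2)
      (hpn.sublist (List.take_sublist ..)) (fun h => hpx (List.mem_of_mem_take h)) hlen.ge
      (fun a ha => hxp a (List.mem_of_mem_take (List.mem_of_mem_head? ha)))
      (fun a ha => hxp a (List.mem_of_mem_take (List.mem_of_mem_getLast? ha)))
    rwa [hlen] at this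
  -- The segment of `p` is lengthened first, then that of `q`; both must be nonempty, which is why
  -- length 3 was treated apart.
  obtain ⟨s, t, hs, hsp, ht, htq, rfl⟩ : ∃ s t, 1 ≤ s ∧ s ≤ p.length ∧ 1 ≤ t ∧ t ≤ q.length ∧
      i = s + t + 2 := by
    rcases le_total (i - 3) p.length with h | h
    · exact ⟨i - 3, 1, by omega⟩
    · exact ⟨p.length, i - 2 - p.length, by omega⟩
  -- If `y` is the hub of `q`, the segment is reversed so that it still runs from `y` to `x`.
  obtain ⟨r, hr, hrn, hrq, hrt, hrh, hrl⟩ : ∃ r : List V, r.IsChain G.Adj ∧ r.Nodup ∧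
      (∀ a ∈ r, a ∈ q) ∧ r.length = t ∧ (∀ a ∈ r.head?, G.Adj y a) ∧
      ∀ a ∈ r.getLast?, G.Adj x a := by
    have hn := hqn.sublist (List.take_sublist t q)
    have hlen : (q.take t).length = t := by simp [htq]
    have hhead : (q.take t).head? = q.head? := by
      rw [List.head?_take, if_neg (by omega)]
    rcases h with ⟨h1, h2⟩ | ⟨h1, h2⟩
    · exact ⟨q.take t, hq.take t, hn, fun a => List.mem_of_mem_take, hlen, hhead ▸ h2,
        fun a ha => h1 a (List.mem_of_mem_take (List.mem_of_mem_getLast? ha))⟩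
    · refine ⟨(q.take t).reverse, ?_, List.nodup_reverse.2 hn,
        fun a ha => List.mem_of_mem_take (List.mem_reverse.1 ha), by rw [List.length_reverse, hlen],
        fun a ha => h1 a (List.mem_of_mem_take (List.mem_reverse.1 (List.mem_of_mem_head? ha))), ?_⟩
      · rw [List.isChain_reverse]
        exact (hq.take t).imp fun a b h => h.symm
      · rw [List.getLast?_reverse, hhead]
        exact h2
  have hlen : (p.take s).length = s := by simp [hsp]
  have hhead : (p.take s).head? = p.head? := by
    rw [List.head?_take, if_neg (by omega)]
  rw [← hlen, ← hrt]
  exact exists_isCycle_of_two_paths hxy (hp.take s) (hpn.sublist (List.take_sublist ..)) hr hrn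
    (fun h => hpx (List.mem_of_mem_take h)) (fun h => hpy (List.mem_of_mem_take h))
    (fun h => hqx (hrq _ h)) (fun h => hqy (hrq _ h))
    (fun a ha h => hpq a (List.mem_of_mem_take ha) (hrq _ h))
    (fun h => by simp [h] at hlen; omega) (fun h => by simp [h] at hrt; omega)
    (hhead ▸ hyp) (fun a ha => hxp a (List.mem_of_mem_take (List.mem_of_mem_getLast? ha)))
    hrh hrl

end SimpleGraph

/-! ### Critical graphs and their cubic components -/

namespace SimpleGraph

variable {V : Type*} [Fintype V] [DecidableEq V] (G : SimpleGraph V) [DecidableRel G.Adj]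

/-- A graph with `2n - 2` edges all of whose proper induced subgraphs have a vertex of degree at
most two, and whose vertices of degree other than three are independent. -/
structure IsCritical : Prop where
  exists_degIn_le : ∀ S : Finset V, S.Nonempty → S ≠ Finset.univ → ∃ v ∈ S, G.degIn S v ≤ 2
  adjCount_univ_add : G.adjCount Finset.univ Finset.univ + 4 = 4 * Fintype.card V
  three_le_degree : ∀ v, 3 ≤ G.degree v
  degree_eq_three_or : ∀ u v, G.Adj u v → G.degree u = 3 ∨ G.degree v = 3

/-- `C` is the vertex set of a connected component of the subgraph induced by the vertices of
degree three. -/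
structure IsCubicComponent (C : Finset V) : Prop where
  nonempty : C.Nonempty
  degree_eq : ∀ v ∈ C, G.degree v = 3
  degree_ne : ∀ v ∈ C, ∀ x, x ∉ C → G.Adj v x → G.degree x ≠ 3
  cutConnected : G.CutConnected C

variable {G}

/-- Each peeled vertex costs at most two edges, and the last two vertices span at most one. -/
lemma adjCount_add_six_le
    (h : ∀ S : Finset V, S.Nonempty → S ≠ Finset.univ → ∃ v ∈ S, G.degIn S v ≤ 2)
    (S : Finset V) (hS : S ≠ Finset.univ) (h2 : 2 ≤ S.card) :
    G.adjCount S S + 6 ≤ 4 * S.card := by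
  obtain ⟨k, hk⟩ : ∃ k, S.card = k + 2 := ⟨S.card - 2, by omega⟩
  induction k generalizing S with
  | zero =>
    obtain ⟨a, b, hab, rfl⟩ := Finset.card_eq_two.1 hk
    have h1 := G.adjCount_union_self (A := {a}) (B := {b}) (by simpa using hab)
    rw [adjCount_singleton_self, adjCount_singleton_self, adjCount_singleton_left,
      degIn_singleton] at h1
    rw [Finset.insert_eq, h1, ← Finset.insert_eq, hk]
    split_ifs <;> omega
  | succ k ih =>
    obtain ⟨v, hv, hd⟩ := h S (Finset.card_pos.1 (by omega)) hS
    have h1 := G.adjCount_erase hv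
    have hc := Finset.card_erase_of_mem hv
    have := ih (S.erase v) (fun h => by have := Finset.mem_univ v; rw [← h] at this; simp at this)
      (by omega) (by omega)
    omega

lemma degree_ge_three_of_adjCount_univ
    (h : ∀ S : Finset V, S.Nonempty → S ≠ Finset.univ → ∃ v ∈ S, G.degIn S v ≤ 2)
    (hE : G.adjCount Finset.univ Finset.univ + 4 = 4 * Fintype.card V)
    (hn : 3 ≤ Fintype.card V) (v : V) : 3 ≤ G.degree v := by
  have h1 := G.adjCount_erase (Finset.mem_univ v)
  have hc := Finset.card_erase_of_mem (Finset.mem_univ v)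
  rw [Finset.card_univ] at hc
  have := adjCount_add_six_le h (Finset.univ.erase v)
    (fun h => by have := Finset.mem_univ v; rw [← h] at this; simp at this) (by omega)
  rw [degIn_univ] at h1
  omega

namespace IsCritical

variable (hG : G.IsCritical)
include hG

lemma adjCount_le (S : Finset V) (hS : S ≠ Finset.univ) (h2 : 2 ≤ S.card) :
    G.adjCount S S + 6 ≤ 4 * S.card :=
  adjCount_add_six_le hG.exists_degIn_le S hS h2

/-- A cubic component induces a tree, and its removal leaves the maximum number of edges. -/
lemma adjCount_cubicComponent {C : Finset V} (hC : G.IsCubicComponent C) (h2 : 2 ≤ Cᶜ.card) :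
    G.adjCount C C + 2 = 2 * C.card ∧ G.adjCount Cᶜ Cᶜ + 6 = 4 * Cᶜ.card := by
  -- The lower bound for the connected set `C` and the upper bound for `Cᶜ` leave no slack in the
  -- edge count, so both are equalities.
  have h1 := G.adjCount_sdiff (Finset.subset_univ C)
  rw [G.adjCount_univ_of_degree_eq hC.degree_eq, ← Finset.compl_eq_univ_sdiff] at h1
  have h3 := hG.adjCount_univ_add
  have h4 := hG.adjCount_le Cᶜ (fun h => by
    have := hC.nonempty; rw [Finset.compl_eq_univ_iff] at h; simp [h] at this) h2
  have h5 := hC.cutConnected.two_mul_card_le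
  have h6 := C.card_add_card_compl
  omega

/-- A cubic vertex outside `C` keeps its three neighbours there. A vertex with fewer than two would,
once removed, leave too many edges for the remaining set of at least two vertices. -/
lemma exists_degIn_compl_eq_two {C : Finset V} (hC : G.IsCubicComponent C) (h3 : 3 ≤ Cᶜ.card) :
    ∃ w ∉ C, G.degree w ≠ 3 ∧ G.degIn Cᶜ w = 2 := by
  have hne : Cᶜ ≠ Finset.univ := fun h => by
    have := hC.nonempty; rw [Finset.compl_eq_univ_iff] at h; simp [h] at this
  obtain ⟨w, hw, hd⟩ := hG.exists_degIn_le Cᶜ (Finset.card_pos.1 (by omega)) hne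
  obtain ⟨-, ht⟩ := hG.adjCount_cubicComponent hC (by omega)
  refine ⟨w, Finset.mem_compl.1 hw, fun h => ?_, ?_⟩
  · have h1 := G.degIn_compl C w
    rw [G.degIn_eq_zero.2 fun x hx hwx =>
      hC.degree_ne x hx w (Finset.mem_compl.1 hw) hwx.symm h] at h1
    omega
  · have h1 := G.adjCount_erase hw
    have hc := Finset.card_erase_of_mem hw
    have := hG.adjCount_le (Cᶜ.erase w)
      (fun h => by have := Finset.mem_univ w; rw [← h] at this; simp at this) (by omega)
    omega

/-- Removing `C`, `w` and `D` would leave a set `S` with `2|S| - 2` edges. A third noncubic vertex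
ensures `|S| ≥ 2`, contradicting the bound. -/
lemma card_degree_ne_three_le_two_of_shared {C D : Finset V} (hC : G.IsCubicComponent C)
    (hD : G.IsCubicComponent D) (hCD : Disjoint C D) {w : V} (hw : G.degree w ≠ 3)
    (hwC : G.degIn Cᶜ w = 2) (hwD : G.degIn D w = 2) :
    (Finset.univ.filter fun v => G.degree v ≠ 3).card ≤ 2 := by
  by_contra! hcon
  set I := Finset.univ.filter fun v => G.degree v ≠ 3 with hI
  have hIC : ∀ {A}, G.IsCubicComponent A → Disjoint A I := fun hA =>
    Finset.disjoint_left.2 fun v hv hv' => (Finset.mem_filter.1 hv').2 (hA.degree_eq v hv)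
  have hICc : ∀ {A}, G.IsCubicComponent A → I ⊆ Aᶜ := fun hA =>
    Finset.subset_compl_iff_disjoint_left.2 (hIC hA)
  have hwI : w ∈ I := by simp [hI, hw]
  obtain ⟨-, ht⟩ := hG.adjCount_cubicComponent hC
    (by have := Finset.card_le_card (hICc hC); omega)
  obtain ⟨htD, -⟩ := hG.adjCount_cubicComponent hD
    (by have := Finset.card_le_card (hICc hD); omega)
  have hwCc := hICc hC hwI
  have h1 := G.adjCount_erase hwCc
  have hc := Finset.card_erase_of_mem hwCc
  set S := Cᶜ.erase w with hS
  have hDS : D ⊆ S := fun v hv => Finset.mem_erase.2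
    ⟨fun h => Finset.disjoint_left.1 (hIC hD) hv (h ▸ hwI),
      Finset.mem_compl.2 (Finset.disjoint_right.1 hCD hv)⟩
  have h2 := G.adjCount_sdiff hDS
  have hIS : I.erase w ⊆ S \ D := fun v hv => by
    rw [Finset.mem_erase] at hv
    exact Finset.mem_sdiff.2 ⟨Finset.mem_erase.2 ⟨hv.1, hICc hC hv.2⟩,
      Finset.mem_compl.1 (hICc hD hv.2)⟩
  have h3 := Finset.card_le_card hIS
  rw [Finset.card_erase_of_mem hwI] at h3
  have h4 := hG.adjCount_le (S \ D) (fun h => by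
    have := Finset.mem_univ w; rw [← h] at this; simp [hS] at this) (by omega)
  have h5 := Finset.card_sdiff_add_card_eq_card hDS
  have hU : (Finset.univ : Finset V) = C ∪ ({w} ∪ S) := by
    rw [hS, ← Finset.insert_eq, Finset.insert_erase hwCc, Finset.union_compl]
  have h6 : G.adjCount D Finset.univ = D.card * 3 :=
    G.adjCount_univ_of_degree_eq hD.degree_eq
  have hd1 : Disjoint C ({w} ∪ S) := by
    rw [hS, ← Finset.insert_eq, Finset.insert_erase hwCc]
    exact disjoint_compl_right
  rw [hU, adjCount_union_right _ hd1, adjCount_union_right _ (by simp [hS]),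
    adjCount_singleton_right, hwD, G.adjCount_eq_zero (A := D) (B := C)
      (fun a ha b hb hab => hD.degree_ne a ha b (Finset.disjoint_left.1 hCD hb) hab
        (hC.degree_eq b hb))] at h6
  have h7 : 2 ≤ Cᶜ.card := by omega
  have h8 := Finset.card_pos.2 hD.nonempty
  have h9 := Finset.card_le_card hDS
  omega

end IsCritical

variable (G) in
/-- The cubic components partition the vertices of degree three. -/
lemma exists_cubicComponents : ∃ P : Finset (Finset V), (∀ C ∈ P, G.IsCubicComponent C) ∧
    (P : Set (Finset V)).PairwiseDisjoint id ∧
    P.biUnion id = Finset.univ.filter fun v => G.degree v = 3 := by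
  classical
  let H : SimpleGraph V :=
    { Adj := fun x y => G.Adj x y ∧ G.degree x = 3 ∧ G.degree y = 3
      symm := ⟨fun x y h => ⟨h.1.symm, h.2.2, h.2.1⟩⟩
      loopless := ⟨fun x h => G.irrefl h.1⟩ }
  let T := Finset.univ.filter fun v => G.degree v = 3
  have hT : ∀ v, v ∈ T ↔ G.degree v = 3 := fun v => by simp [T]
  refine ⟨T.image fun x => T.filter (H.Reachable x), ?_, ?_, ?_⟩
  · intro C hC
    obtain ⟨z, hz, rfl⟩ := Finset.mem_image.1 hC
    refine ⟨⟨z, Finset.mem_filter.2 ⟨hz, .refl _⟩⟩,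
      fun v hv => (hT v).1 (Finset.mem_filter.1 hv).1, ?_, ?_⟩
    · intro v hv x hx hvx h3
      rw [Finset.mem_filter] at hv hx
      have hadj : H.Adj v x := ⟨hvx, (hT v).1 hv.1, h3⟩
      exact hx ⟨(hT x).2 h3, hv.2.trans hadj.reachable⟩
    · intro X hX ⟨x, hx⟩ hne
      obtain ⟨y, hy, hyX⟩ := Finset.exists_of_ssubset (hX.ssubset_of_ne hne)
      have hx' := Finset.mem_filter.1 (hX hx)
      have hy' := Finset.mem_filter.1 hy
      obtain ⟨p⟩ := hx'.2.symm.trans hy'.2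
      obtain ⟨d, hd, h1, h2⟩ := p.exists_boundary_dart (X : Set V) hx hyX
      have h1' := Finset.mem_filter.1 (hX h1)
      refine ⟨d.fst, h1, d.snd, Finset.mem_sdiff.2 ⟨Finset.mem_filter.2
        ⟨(hT _).2 d.adj.2.2, h1'.2.trans d.adj.reachable⟩, h2⟩, d.adj.1⟩
  · intro A hA B hB hAB
    obtain ⟨a, ha, rfl⟩ := Finset.mem_image.1 hA
    obtain ⟨b, hb, rfl⟩ := Finset.mem_image.1 hB
    refine Finset.disjoint_left.2 fun v hva hvb => hAB ?_
    have hab := (Finset.mem_filter.1 hva).2.trans (Finset.mem_filter.1 hvb).2.symm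
    exact Finset.filter_congr fun v _ => ⟨fun h => hab.symm.trans h, fun h => hab.trans h⟩
  · ext v
    simp only [Finset.mem_biUnion, Finset.mem_image, id]
    constructor
    · rintro ⟨_, ⟨a, ha, rfl⟩, hv⟩
      exact (Finset.mem_filter.1 hv).1
    · intro hv
      exact ⟨_, ⟨v, hv, rfl⟩, Finset.mem_filter.2 ⟨hv, .refl _⟩⟩

namespace IsCritical

variable (hG : G.IsCritical)
include hG

/-- Noncubic vertices are independent and the components are trees, so there are `3|T| - (|T| -
|P|)` edges; compare with `2(|T| + |I|) - 2`. -/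
lemma card_cubicComponents_add_two {P : Finset (Finset V)} (hP : ∀ C ∈ P, G.IsCubicComponent C)
    (hPd : (P : Set (Finset V)).PairwiseDisjoint id)
    (hPu : P.biUnion id = Finset.univ.filter fun v => G.degree v = 3)
    (hI : 2 ≤ (Finset.univ.filter fun v => G.degree v ≠ 3).card) :
    P.card + 2 = 2 * (Finset.univ.filter fun v => G.degree v ≠ 3).card := by
  set I := Finset.univ.filter fun v => G.degree v ≠ 3 with hIdef
  set T := Finset.univ.filter fun v => G.degree v = 3 with hTdef
  have hTI : Disjoint T I := Finset.disjoint_filter_filter_not _ _ _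
  have hU : (Finset.univ : Finset V) = T ∪ I := (Finset.filter_union_filter_not_eq _ _).symm
  have hcard : Fintype.card V = T.card + I.card := by
    rw [← Finset.card_univ, hU, Finset.card_union_of_disjoint hTI]
  have hII : G.adjCount I I = 0 := G.adjCount_eq_zero fun a ha b hb hab => by
    rw [hIdef, Finset.mem_filter] at ha hb
    exact (hG.degree_eq_three_or a b hab).elim ha.2 hb.2
  have hE := hG.adjCount_univ_add
  have hT3 : G.adjCount T Finset.univ = T.card * 3 :=
    G.adjCount_univ_of_degree_eq fun v hv => (Finset.mem_filter.1 hv).2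
  rw [hU, adjCount_union_self _ hTI, hII] at hE
  rw [hU, adjCount_union_right _ hTI] at hT3
  have hTc : T.card = ∑ C ∈ P, C.card := by
    rw [← hPu, Finset.card_biUnion fun C hC D hD h => hPd hC hD h]; rfl
  have hTT : G.adjCount T T = ∑ C ∈ P, G.adjCount C C := by
    rw [adjCount, ← hPu, Finset.sum_biUnion hPd]
    refine Finset.sum_congr rfl fun C hC => Finset.sum_congr rfl fun v hv => ?_
    have hsub : C ⊆ P.biUnion id := Finset.subset_biUnion_of_mem id hC
    have h1 := G.degIn_union (Finset.disjoint_sdiff (s := C) (t := P.biUnion id)) v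
    rw [Finset.union_sdiff_of_subset hsub] at h1
    rw [h1, add_eq_left, degIn_eq_zero]
    intro x hx hvx
    rw [Finset.mem_sdiff, hPu] at hx
    exact (hP C hC).degree_ne v hv x hx.2 hvx (Finset.mem_filter.1 hx.1).2
  have hsum : ∑ C ∈ P, (G.adjCount C C + 2) = ∑ C ∈ P, 2 * C.card := by
    refine Finset.sum_congr rfl fun C hC => (hG.adjCount_cubicComponent (hP C hC) ?_).1
    refine hI.trans (Finset.card_le_card fun v hv => Finset.mem_compl.2 fun hvC => ?_)
    exact (Finset.mem_filter.1 hv).2 ((hP C hC).degree_eq v hvC)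
  rw [Finset.sum_add_distrib, Finset.sum_const, smul_eq_mul, ← Finset.mul_sum, ← hTT,
    ← hTc] at hsum
  omega

/-- The complement of a cubic component contains at least three vertices, if there are two
vertices of degree other than three and another cubic component. -/
lemma three_le_card_compl {C D : Finset V} (hC : G.IsCubicComponent C)
    (hD : G.IsCubicComponent D) (hCD : Disjoint C D)
    (hI : 2 ≤ (Finset.univ.filter fun v => G.degree v ≠ 3).card) : 3 ≤ Cᶜ.card := by
  obtain ⟨d, hd⟩ := hD.nonempty
  have h1 : insert d (Finset.univ.filter fun v => G.degree v ≠ 3) ⊆ Cᶜ := by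
    intro v hv
    rw [Finset.mem_compl]
    rcases Finset.mem_insert.1 hv with rfl | hv
    · exact Finset.disjoint_right.1 hCD hd
    · exact fun hvC => (Finset.mem_filter.1 hv).2 (hC.degree_eq v hvC)
  have h2 := Finset.card_le_card h1
  rw [Finset.card_insert_of_notMem (by simp [hD.degree_eq d hd])] at h2
  omega

lemma card_degree_ne_three_le_two :
    (Finset.univ.filter fun v => G.degree v ≠ 3).card ≤ 2 := by
  by_contra! hcon
  obtain ⟨P, hP, hPd, hPu⟩ := G.exists_cubicComponents
  have hcard := hG.card_cubicComponents_add_two hP hPd hPu hcon.le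
  have hw : ∀ C ∈ P, ∃ w, G.degree w ≠ 3 ∧ G.degIn Cᶜ w = 2 := by
    intro C hC
    obtain ⟨D, hD, hDC⟩ := Finset.exists_mem_ne (by omega : 1 < P.card) C
    obtain ⟨w, -, h⟩ := hG.exists_degIn_compl_eq_two (hP C hC)
      (hG.three_le_card_compl (hP C hC) (hP D hD) (hPd hC hD hDC.symm) hcon.le)
    exact ⟨w, h⟩
  obtain ⟨v, -⟩ := Finset.card_pos.1 (by omega :
    0 < (Finset.univ.filter fun v => G.degree v ≠ 3).card)
  have : Nonempty V := ⟨v⟩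
  choose! f hf using hw
  obtain ⟨C, hC, D, hD, hCD, hfCD⟩ := Finset.exists_ne_map_eq_of_card_lt_of_maps_to
    (s := P) (t := Finset.univ.filter fun v => G.degree v ≠ 3) (f := f) (by omega)
    (fun C hC => by simpa using (hf C hC).1)
  have hdis : Disjoint C D := hPd hC hD hCD
  obtain ⟨h3, h2⟩ := hf C hC
  obtain ⟨-, h2'⟩ := hf D hD
  rw [← hfCD] at h2'
  -- The shared vertex has two neighbours outside each component, so its degree is at most four; not
  -- being three, it is four, with two neighbours in each.
  have h4 := hG.three_le_degree (f C)
  have e1 := G.degIn_compl C (f C)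
  have e2 := G.degIn_compl D (f C)
  have l1 := G.degIn_mono (Finset.subset_compl_iff_disjoint_right.2 hdis) (f C)
  have l2 := G.degIn_mono (Finset.subset_compl_iff_disjoint_left.2 hdis) (f C)
  have := hG.card_degree_ne_three_le_two_of_shared (hP C hC) (hP D hD) hdis h3 h2 (by omega)
  omega

/-- If there are two cubic components and two further vertices, then one of the two is adjacent to
all vertices of a given component and the other to exactly two of them. -/
lemma exists_fan {C D : Finset V} (hC : G.IsCubicComponent C) (hD : G.IsCubicComponent D)
    (hCD : Disjoint C D) (hI : (Finset.univ.filter fun v => G.degree v ≠ 3).card = 2)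
    (hCDI : C ∪ D = Finset.univ.filter fun v => G.degree v = 3) :
    ∃ x y, x ≠ y ∧ G.degree x ≠ 3 ∧ G.degree y ≠ 3 ∧ (∀ v ∈ D, G.Adj x v) ∧
      G.degIn D y = 2 := by
  obtain ⟨y, hyC, hy3, hy⟩ := hG.exists_degIn_compl_eq_two hC
    (hG.three_le_card_compl hC hD hCD hI.ge)
  set I := Finset.univ.filter fun v => G.degree v ≠ 3 with hIdef
  have hyI : y ∈ I := by simp [hIdef, hy3]
  obtain ⟨x, hx⟩ := Finset.card_eq_one.1
    (show (I.erase y).card = 1 by rw [Finset.card_erase_of_mem hyI, hI])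
  have hIxy : I = {y} ∪ {x} := by rw [← hx, ← Finset.insert_eq, Finset.insert_erase hyI]
  have hxy : x ≠ y := (Finset.mem_erase.1 (hx ▸ Finset.mem_singleton_self x : x ∈ I.erase y)).1
  have hxI : x ∈ I := by simp [hIxy]
  have hTI : Disjoint (C ∪ D) I := hCDI ▸ Finset.disjoint_filter_filter_not _ _ _
  have hU : (Finset.univ : Finset V) = (C ∪ D) ∪ I := by
    rw [hCDI]; exact (Finset.filter_union_filter_not_eq _ _).symm
  have hII : ∀ v ∈ I, G.degIn I v = 0 := fun v hv => G.degIn_eq_zero.2 fun b hb hab => by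
    rw [hIdef, Finset.mem_filter] at hv hb
    exact (hG.degree_eq_three_or v b hab).elim hv.2 hb.2
  have hyD : G.degIn D y = 2 := by
    have h1 := G.degIn_compl C y
    rw [← degIn_univ, hU, degIn_union _ hTI, degIn_union _ hCD, hII y hyI] at h1
    omega
  refine ⟨x, y, hxy, (Finset.mem_filter.1 hxI).2, hy3, ?_, hyD⟩
  -- Of the `3|D|` edge ends in `D`, the tree takes `2|D| - 2` and `y` takes two, which leaves `|D|`
  -- for `x`.
  have h6 : G.adjCount D Finset.univ = D.card * 3 :=
    G.adjCount_univ_of_degree_eq hD.degree_eq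
  rw [hU, adjCount_union_right _ hTI, adjCount_union_right _ hCD, hIxy,
    adjCount_union_right _ (by simpa using hxy.symm),
    adjCount_singleton_right, adjCount_singleton_right, hyD, G.adjCount_eq_zero (A := D) (B := C)
      (fun a ha b hb hab => hD.degree_ne a ha b (Finset.disjoint_left.1 hCD hb) hab
        (hC.degree_eq b hb))] at h6
  have h7 := (hG.adjCount_cubicComponent hD (by
    have := hG.three_le_card_compl hD hC hCD.symm hI.ge; omega)).1
  have h8 : D.card ≤ (D.filter (G.Adj x)).card := by unfold degIn at h6; omega
  intro v hv
  exact (Finset.mem_filter.1 ((Finset.eq_of_subset_of_card_le (Finset.filter_subset _ _) h8).symm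
    ▸ hv : v ∈ D.filter (G.Adj x))).2

end IsCritical

/-- The list of vertices of a fan. -/
lemma IsCubicComponent.exists_path {C : Finset V} (hC : G.IsCubicComponent C) {x y : V}
    (hxy : x ≠ y) (hx3 : G.degree x ≠ 3) (hy3 : G.degree y ≠ 3) (hx : ∀ v ∈ C, G.Adj x v)
    (hy : G.degIn C y = 2) :
    ∃ l : List V, l.IsChain G.Adj ∧ l.Nodup ∧ (∀ v ∈ l, v ∈ C) ∧ l.length = C.card ∧
      2 ≤ l.length ∧ ∀ a ∈ l.head?, G.Adj y a := by
  have hxC : x ∈ Cᶜ := Finset.mem_compl.2 fun h => hx3 (hC.degree_eq x h)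
  have hyC : y ∈ Cᶜ := Finset.mem_compl.2 fun h => hy3 (hC.degree_eq y h)
  have hdeg : ∀ v ∈ C, G.degIn C v ≤ 2 := by
    intro v hv
    have h1 := G.degIn_compl C v
    have h2 := card_le_degIn (G := G) (S := Cᶜ) (A := {x}) (v := v) (by simpa using hxC)
      (by simpa using (hx v hv).symm)
    rw [hC.degree_eq v hv] at h1
    rw [Finset.card_singleton] at h2
    omega
  obtain ⟨q, hq⟩ := Finset.card_pos.1 (by unfold degIn at hy; omega : 0 < (C.filter (G.Adj y)).card)
  rw [Finset.mem_filter] at hq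
  -- Both `x` and `y` are neighbours of `q` outside `C`.
  have hq1 : G.degIn C q ≤ 1 := by
    have h1 := G.degIn_compl C q
    have h2 := card_le_degIn (G := G) (S := Cᶜ) (A := {x, y}) (v := q)
      (by simp [Finset.insert_subset_iff, hxC, hyC, -Finset.mem_compl])
      (by simpa using ⟨(hx q hq.1).symm, hq.2.symm⟩)
    rw [hC.degree_eq q hq.1] at h1
    rw [Finset.card_pair hxy] at h2
    omega
  obtain ⟨l, hc, hn, hl, hlen⟩ := hC.cutConnected.exists_hamiltonian_path_from hdeg hq.1 hq1
  refine ⟨q :: l, hc, hn, hl, hlen, ?_, by simpa using hq.2⟩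
  rw [hlen, ← hy]
  exact Finset.card_filter_le _ _

/-! ### The wheel and the double fan -/

namespace IsCritical

variable (hG : G.IsCritical)
include hG

lemma isPancyclic_of_degree_eq_three {w : V} (hw : ∀ v, v ≠ w → G.degree v = 3) :
    IsPancyclic G := by
  intro i hi3 hin
  set R := Finset.univ.erase w with hR
  have hRc : R.card + 1 = Fintype.card V := by
    rw [hR, Finset.card_erase_add_one (Finset.mem_univ _), Finset.card_univ]
  have hwR : w ∉ R := by simp [hR]
  have hU : (Finset.univ : Finset V) = {w} ∪ R := by
    rw [hR, ← Finset.insert_eq, Finset.insert_erase (Finset.mem_univ w)]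
  have hR3 : ∀ v ∈ R, G.degree v = 3 := fun v hv => hw v (Finset.ne_of_mem_erase hv)
  have hdis : Disjoint {w} R := by simpa using hwR
  have hE := hG.adjCount_univ_add
  -- The degree sum `4n - 4` exceeds `3(n - 1)` by `n - 1`, so `w` is adjacent to everything.
  have hwdeg : R.card ≤ (R.filter (G.Adj w)).card := by
    have h1 : G.adjCount Finset.univ Finset.univ = G.degree w + R.card * 3 := by
      rw [adjCount_univ_right]
      conv_lhs => rw [hU]
      rw [Finset.sum_union hdis, Finset.sum_singleton, Finset.sum_congr rfl hR3, Finset.sum_const,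
        smul_eq_mul]
    have h2 : G.degree w = (R.filter (G.Adj w)).card := by
      rw [← degIn_univ, hU, degIn_union _ hdis, degIn_singleton, if_neg G.irrefl, zero_add, degIn]
    omega
  have hadj : ∀ v ∈ R, G.Adj w v := fun v hv =>
    (Finset.mem_filter.1 ((Finset.eq_of_subset_of_card_le (Finset.filter_subset _ _) hwdeg).symm
      ▸ hv : v ∈ R.filter (G.Adj w))).2
  have hdeg : ∀ v ∈ R, G.degIn R v = 2 := by
    intro v hv
    have h1 := hR3 v hv
    rw [← degIn_univ, hU, degIn_union _ hdis, degIn_singleton, if_pos (hadj v hv).symm] at h1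
    omega
  -- A part `X` of the 2-regular set `R` with no edge to the rest of `R` meets only `2|X|` edges, so
  -- `Xᶜ` would keep `2|Xᶜ| - 2`.
  have hcut : G.CutConnected R := by
    intro X hX hXne hXR
    by_contra! hcon
    obtain ⟨z, hz, hzX⟩ := Finset.exists_of_ssubset (hX.ssubset_of_ne hXR)
    have h1 := G.adjCount_sdiff (Finset.subset_univ X)
    rw [G.adjCount_univ_of_degree_eq fun v hv => hR3 v (hX hv), ← Finset.compl_eq_univ_sdiff] at h1
    have h2 : G.adjCount X X = X.card * 2 := by
      rw [adjCount, Finset.sum_congr rfl fun v hv => ?_, Finset.sum_const, smul_eq_mul]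
      have h3 := G.degIn_union (Finset.disjoint_sdiff (s := X) (t := R)) v
      rwa [Finset.union_sdiff_of_subset hX, hdeg v (hX hv), G.degIn_eq_zero.2 (hcon v hv),
        add_zero, eq_comm] at h3
    have h3 : 2 ≤ Xᶜ.card := by
      have : ({w, z} : Finset V) ⊆ Xᶜ := by
        simpa [Finset.insert_subset_iff] using ⟨fun h => hwR (hX h), hzX⟩
      have h4 := Finset.card_le_card this
      rwa [Finset.card_pair (by rintro rfl; exact hwR hz)] at h4
    have h4 := hG.adjCount_le Xᶜ (fun h => by
      rw [Finset.compl_eq_univ_iff] at h; simp [h] at hXne) h3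
    have h5 := X.card_add_card_compl
    omega
  obtain ⟨l, hc, hn, hlR, hlen⟩ := hcut.exists_hamiltonian_path (Finset.card_pos.1 (by omega))
    fun v hv => (hdeg v hv).le
  have hlen' : (l.take (i - 1)).length = i - 1 := by
    rw [List.length_take]; omega
  have := exists_isCycle_of_isChain (G := G) (x := w) (l := l.take (i - 1)) (hc.take _)
    (hn.sublist (List.take_sublist ..)) (fun h => hwR (hlR _ (List.mem_of_mem_take h)))
    (by omega)
    (fun a ha => hadj a (hlR a (List.mem_of_mem_take (List.mem_of_mem_head? ha))))
    (fun a ha => hadj a (hlR a (List.mem_of_mem_take (List.mem_of_mem_getLast? ha))))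
  rwa [hlen', Nat.sub_add_cancel (by omega)] at this

lemma isPancyclic_of_card_degree_ne_three_eq_two
    (hI : (Finset.univ.filter fun v => G.degree v ≠ 3).card = 2) : IsPancyclic G := by
  intro i hi3 hin
  obtain ⟨P, hP, hPd, hPu⟩ := G.exists_cubicComponents
  have hcard := hG.card_cubicComponents_add_two hP hPd hPu hI.ge
  obtain ⟨C, D, hCD, rfl⟩ := Finset.card_eq_two.1 (by omega : P.card = 2)
  have hC := hP C (by simp)
  have hD := hP D (by simp)
  have hdis : Disjoint C D := hPd (by simp) (by simp) hCD
  have hu : C ∪ D = Finset.univ.filter fun v => G.degree v = 3 := by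
    rw [← hPu]; simp
  obtain ⟨x, y, hxy, hx3, hy3, hx, hy⟩ :=
    hG.exists_fan hD hC hdis.symm hI (by rw [Finset.union_comm, hu])
  obtain ⟨x', y', hxy', hx3', hy3', hx', hy'⟩ := hG.exists_fan hC hD hdis hI hu
  obtain ⟨p, hpc, hpn, hpC, hpl, hp2, hph⟩ := hC.exists_path hxy hx3 hy3 hx hy
  obtain ⟨q, hqc, hqn, hqD, hql, hq2, hqh⟩ := hD.exists_path hxy' hx3' hy3' hx' hy'
  have hIxy : (Finset.univ.filter fun v => G.degree v ≠ 3) = {x, y} := by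
    refine (Finset.eq_of_subset_of_card_le ?_ ?_).symm
    · simp [Finset.insert_subset_iff, hx3, hy3]
    · rw [hI, Finset.card_pair hxy]
  have hmem : ∀ v, G.degree v ≠ 3 → v = x ∨ v = y := fun v hv => by
    have : v ∈ Finset.univ.filter fun v => G.degree v ≠ 3 := by simp [hv]
    rw [hIxy] at this
    simpa using this
  have hn : Fintype.card V = p.length + q.length + 2 := by
    have h1 := Finset.card_filter_add_card_filter_not (s := (Finset.univ : Finset V))
      (fun v => G.degree v = 3)
    rw [← hu, hI, Finset.card_union_of_disjoint hdis, Finset.card_univ] at h1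
    omega
  refine exists_isCycle_of_two_fans hxy hpc hpn hqc hqn
    (fun h => hx3 (hC.degree_eq _ (hpC _ h))) (fun h => hy3 (hC.degree_eq _ (hpC _ h)))
    (fun h => hx3 (hD.degree_eq _ (hqD _ h))) (fun h => hy3 (hD.degree_eq _ (hqD _ h)))
    (fun a ha h => Finset.disjoint_left.1 hdis (hpC a ha) (hqD a h)) hp2
    (by rintro rfl; simp at hq2) (fun a ha => hx a (hpC a ha)) hph ?_ hi3 (hn ▸ hin)
  rcases hmem x' hx3' with rfl | rfl
  · obtain rfl := (hmem y' hy3').resolve_left hxy'.symm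
    exact .inl ⟨fun a ha => hx' a (hqD a ha), hqh⟩
  · obtain rfl := (hmem y' hy3').resolve_right hxy'.symm
    exact .inr ⟨fun a ha => hx' a (hqD a ha), hqh⟩

theorem isPancyclic [Nonempty V] : IsPancyclic G := by
  rcases hG.card_degree_ne_three_le_two.eq_or_lt with h | h
  · exact hG.isPancyclic_of_card_degree_ne_three_eq_two h
  · obtain ⟨w, hw⟩ := Finset.card_le_one_iff_subset_singleton.1 (Nat.lt_succ_iff.1 h)
    refine hG.isPancyclic_of_degree_eq_three (w := w) fun v hv => ?_
    by_contra h3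
    exact hv (Finset.mem_singleton.1 (hw (by simp [h3])))

end IsCritical

/-- The two kinds of proper subgraph needed are induced ones and the graph minus an edge joining two
vertices of degree at least four. -/
lemma isCritical_of_no_proper_subgraph
    (hE : G.adjCount Finset.univ Finset.univ + 4 = 4 * Fintype.card V)
    (hn : 3 ≤ Fintype.card V)
    (hG : ∀ H : G.Subgraph, H ≠ ⊤ → ¬ SubgraphHasMinDegree H 3) : G.IsCritical := by
  have hlow : ∀ S : Finset V, S.Nonempty → S ≠ Finset.univ → ∃ v ∈ S, G.degIn S v ≤ 2 := by
    intro S hS hSu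
    by_contra! hcon
    refine false_of_three_le_ncard_neighborSet hG ((⊤ : G.Subgraph).induce (S : Set V)) ?_ hS ?_
    · intro h
      have := congrArg Subgraph.verts h
      simp only [Subgraph.induce_verts, Subgraph.verts_top] at this
      exact hSu (Finset.coe_eq_univ.1 this)
    · intro v hv
      have : ((⊤ : G.Subgraph).induce (S : Set V)).neighborSet v = (S.filter (G.Adj v) : Finset V) := by
        ext w
        have hv' : v ∈ S := hv
        simp [hv']
      rw [this, Set.ncard_coe_finset]
      exact hcon v hv
  have h3 := degree_ge_three_of_adjCount_univ hlow hE hn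
  refine ⟨hlow, hE, h3, fun u v huv => ?_⟩
  by_contra! hcon
  refine false_of_three_le_ncard_neighborSet hG ((⊤ : G.Subgraph).deleteEdges {s(u, v)}) ?_
    ⟨u, trivial⟩ fun a _ => ?_
  · intro h
    have h1 : (⊤ : G.Subgraph).Adj u v := huv
    rw [← h] at h1
    simp at h1
  · have hdeg : ((⊤ : G.Subgraph).neighborSet a).ncard = G.degree a := by
      rw [← card_neighborSet_eq_degree, ← Nat.card_eq_fintype_card, Nat.card_coe_set_eq]
      rfl
    by_cases ha : G.degree a = 3
    · have : ((⊤ : G.Subgraph).deleteEdges {s(u, v)}).neighborSet a =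
          (⊤ : G.Subgraph).neighborSet a := by
        ext b
        simp only [Subgraph.mem_neighborSet, Subgraph.deleteEdges_adj, Set.mem_singleton_iff,
          and_iff_left_iff_imp]
        intro _ h
        rcases Sym2.eq_iff.1 h with ⟨rfl, rfl⟩ | ⟨rfl, rfl⟩
        exacts [hcon.1 ha, hcon.2 ha]
      rw [this, hdeg, ha]
    · have h1 := (⊤ : G.Subgraph).ncard_neighborSet_le_deleteEdges u v a
      have h2 := h3 a
      omega

end SimpleGraph

theorem mainTheorem4 {V : Type*} [Fintype V] [DecidableEq V]
    (G : SimpleGraph V) [DecidableRel G.Adj] (n : ℕ)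
    (hn : Fintype.card V = n)
    (he : (G.edgeFinset.card : ℤ) = 2 * (n : ℤ) - 2)
    (hG : ∀ H : G.Subgraph, H ≠ ⊤ → ¬ SubgraphHasMinDegree H 3) :
    IsPancyclic G := by
  by_cases h3 : 3 ≤ Fintype.card V
  · have : Nonempty V := Fintype.card_pos_iff.1 (by omega)
    refine (SimpleGraph.isCritical_of_no_proper_subgraph ?_ h3 hG).isPancyclic
    rw [G.adjCount_univ]
    omega
  · intro i hi hin
    omega
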